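/- Let $\mathbb{K}$ be a field of characteristic zero, $V$ a $\mathbb{K}$-vector space of finite dimension $r\ge 1$, $U=V^*$, and let $X=(x_1,\dots,x_N)$ be a finite sequence of vectors in $U$ (repetitions and zero vectors allowed) that spans $U$. Write $Y\subseteq X$ for subsequences, let $\operatorname{clos}(Y)$ be the closure of $Y$ in the matroid represented by $X$, let $\mathcal{L}(X)$ be the lattice of flats of this matroid, ordered by inclusion, and for a flat $C$ let $m(C)=|X\setminus C|$. In the symmetric algebra $\operatorname{Sym}(U)$, let $p_x$ be the image of $x\in U$ and $p_Y=\prod_{x\in Y}p_x$ for $Y\subseteq X$. For a non-empty upper set $J\subseteq\mathcal{L}(X)$ with indicator function $\chi$, extended to subsequences by $\chi(A)=\chi(\operatorname{clos}(A))$, and for an integer $k\ge -1$, define $\mathcal{P}(X,k,J)\subseteq\operatorname{Sym}(U)$ as the $\mathbb{K}$-linear span of $S(X,k,J)$, where \begin{align*} S(X,k,J)&=\{\,f\,p_Y : Y\subseteq X,\ f\in\operatorname{Sym}(U),\ 0\le\deg f\le \chi(X\setminus Y)+k-1\,\}\quad\text{for }k\ge 1,\\ S(X,0,J)&=\{\,p_Y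 : Y\subseteq X,\ \operatorname{clos}(X\setminus Y)\in J\,\},\\ S(X,-1,J)&=\{\,p_Y : Y\subseteq X,\ |Y\setminus C|<m(C)-1+\chi(C)\text{ for all }C\in\mathcal{L}(X)\setminus\{X\}\,\}. \end{align*} Then for every integer $k\ge -1$, $$\mathcal{P}(X,k,\mathcal{L}(X))=\mathcal{P}(X,k+1,\{X\}).$$ -/

import Mathlib

namespace Zonotopal

noncomputable section

/-- The matroid on the index set `Fin N` represented by a sequence `X = (x_1, …, x_N)` of vectors:
`I` is independent iff the subsequence `(x_i)_{i ∈ I}` is linearly independent. Subsequences of `X`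
are encoded by their index sets, so that repeated vectors are kept apart. -/
def vectorMatroid {K U : Type*} [Field K] [AddCommGroup U] [Module K U] {N : ℕ} (X : Fin N → U) :
    Matroid (Fin N) :=
  (IndepMatroid.ofFinite (E := Set.univ) Set.finite_univ (fun I => LinearIndepOn K X I)
    (linearIndepOn_empty K X)
    (fun _ _ hJ hIJ => LinearIndepOn.mono hJ hIJ)
    (by
      intro I J hI hJ hlt
      by_contra hcon
      push Not at hcon
      have hsub : X '' J ⊆ Submodule.span K (X '' I) := by
        rintro _ ⟨e, he, rfl⟩
        by_cases heI : e ∈ I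
        · exact Submodule.subset_span ⟨e, heI, rfl⟩
        · by_contra hns
          exact hcon e he heI ((linearIndepOn_insert heI).2 ⟨hI, hns⟩)
      have hle : Submodule.span K (X '' J) ≤ Submodule.span K (X '' I) := Submodule.span_le.2 hsub
      have key : ∀ S : Set (Fin N), LinearIndepOn K X S →
          Module.finrank K (Submodule.span K (X '' S)) = S.ncard := by
        intro S hS
        classical
        have : Fintype S := Fintype.ofFinite S
        have h1 := finrank_span_eq_card (R := K) hS
        have h2 : Set.range (fun i : S => X i) = X '' S := by
          ext y; simp
        rw [h2] at h1
        rw [h1, ← Nat.card_coe_set_eq, Nat.card_eq_fintype_card]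
      have : FiniteDimensional K (Submodule.span K (X '' I)) :=
        FiniteDimensional.span_of_finite K (Set.toFinite _)
      have hf := Submodule.finrank_mono hle
      rw [key J hJ, key I hI] at hf
      omega)
    (fun I _ => Set.subset_univ I)).matroid

/-- The lattice of flats `L(X)` of the matroid of `X`, ordered by inclusion. -/
abbrev Flats (K : Type*) {U : Type*} [Field K] [AddCommGroup U] [Module K U] {N : ℕ}
    (X : Fin N → U) : Type :=
  {C : Set (Fin N) // (vectorMatroid (K := K) X).IsFlat C}

section
variable {K U : Type*} [Field K] [AddCommGroup U] [Module K U] {N : ℕ}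

/-- The flat `X` itself, i.e. the whole ground set. -/
def topFlat (K : Type*) {U : Type*} [Field K] [AddCommGroup U] [Module K U] {N : ℕ}
    (X : Fin N → U) : Flats K X :=
  ⟨Set.univ, (vectorMatroid (K := K) X).ground_isFlat⟩

/-- The closure of a subsequence of `X`, as a flat. -/
def clos (X : Fin N → U) (A : Set (Fin N)) : Flats K X :=
  ⟨(vectorMatroid (K := K) X).closure A, (vectorMatroid (K := K) X).isFlat_closure A⟩

/-- `m(C)`, the number of elements of `X` outside the flat `C`. -/
def m {X : Fin N → U} (C : Flats K X) : ℕ := (C.1ᶜ).ncard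

open Classical in
/-- The indicator function of a set `J` of flats. -/
def chi {X : Fin N → U} (J : Set (Flats K X)) (C : Flats K X) : ℤ := if C ∈ J then 1 else 0

/-- The product `p_Y = ∏_{x ∈ Y} p_x` in the symmetric algebra `Sym(U)`, for `Y ⊆ X`. -/
def p (K : Type*) {U : Type*} [Field K] [AddCommGroup U] [Module K U] {N : ℕ}
    (X : Fin N → U) (Y : Finset (Fin N)) : SymmetricAlgebra K U :=
  ∏ i ∈ Y, SymmetricAlgebra.ι K U (X i)

/-- The elements of `Sym(U)` of degree at most `d`: the sum of the homogeneous components of degree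
`0, …, d`, where the component of degree `i` is spanned by the `i`-fold products of vectors. -/
def degreeLE (K U : Type*) [Field K] [AddCommGroup U] [Module K U] (d : ℕ) :
    Submodule K (SymmetricAlgebra K U) :=
  ⨆ i : ℕ, ⨆ _ : i ≤ d, (LinearMap.range (SymmetricAlgebra.ι K U)) ^ i

/-- The generating set `S(X, k, J)`, for an integer `k ≥ -1`:
* for `k ≥ 1`, all `f p_Y` with `Y ⊆ X` and `0 ≤ deg f ≤ χ(X \ Y) + k - 1`, where
  `χ(A) = χ(clos A)` (the lower bound says `f ≠ 0`);
* for `k = 0`, all `p_Y` with `Y ⊆ X` and `clos (X \ Y) ∈ J`;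
* for `k = -1`, all `p_Y` with `Y ⊆ X` and `|Y \ C| < m(C) - 1 + χ(C)` for every flat `C ≠ X`. -/
def S (X : Fin N → U) (k : ℤ) (J : Set (Flats K X)) : Set (SymmetricAlgebra K U) :=
  if 1 ≤ k then
    {q | ∃ (Y : Finset (Fin N)) (f : SymmetricAlgebra K U), f ≠ 0 ∧
      (∃ d : ℕ, (d : ℤ) ≤ chi J (clos X (Y : Set (Fin N))ᶜ) + k - 1 ∧ f ∈ degreeLE K U d) ∧
      q = f * p K X Y}
  else if k = 0 then
    {q | ∃ Y : Finset (Fin N), clos X (Y : Set (Fin N))ᶜ ∈ J ∧ q = p K X Y}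
  else
    {q | ∃ Y : Finset (Fin N),
      (∀ C : Flats K X, C ≠ topFlat K X →
        (((Y : Set (Fin N)) \ C.1).ncard : ℤ) < (m C : ℤ) - 1 + chi J C) ∧
      q = p K X Y}

/-- The hierarchical zonotopal space `P(X, k, J)`, the linear span of `S(X, k, J)`. It is meant for
`k ≥ -1` and `J` a non-empty upper set in the lattice of flats. -/
def PSpace (X : Fin N → U) (k : ℤ) (J : Set (Flats K X)) : Submodule K (SymmetricAlgebra K U) :=
  Submodule.span K (S X k J)

end

end

end Zonotopal

namespace Zonotopal

section

variable {K U : Type*} [Field K] [AddCommGroup U] [Module K U] {N : ℕ}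

/-! For `k = -1` the two generating sets coincide: the inequality for a flat `C` says that `X \ Y`
does not lie in `C`, and `X \ Y` avoids all proper flats in this sense exactly when it spans. For `k
≥ 0` the degree bound is `k` on the left; on the right it is `k + 1` if `X \ Y` spans and `k`
otherwise, so `⊆` is immediate. For `⊇`, only the spanning case is at issue: an `f` of degree `k +
1` is a sum of products `a u` with `u ∈ U`, and expanding `u` in the vectors of `X \ Y` moves one
factor into the product, leaving terms `a p_{Y ∪ {e}}` with `deg a ≤ k`
(`mul_p_mem_PSpace_univ_of_span`). -/

/-- A subsequence of `X` that spans the matroid of `X` has the same linear span as `X`. -/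
theorem span_image_eq_of_spanning (X : Fin N → U) {A : Set (Fin N)}
    (hA : (vectorMatroid (K := K) X).Spanning A) :
    Submodule.span K (X '' A) = Submodule.span K (Set.range X) := by
  obtain ⟨B, hB, hBA⟩ := hA.exists_isBase_subset
  refine le_antisymm (Submodule.span_mono (Set.image_subset_range _ _)) (Submodule.span_le.2 ?_)
  rintro _ ⟨e, rfl⟩
  refine Submodule.span_mono (Set.image_mono hBA) ?_
  by_cases heB : e ∈ B
  · exact Submodule.subset_span ⟨e, heB, rfl⟩
  -- A vector outside the span of the base would enlarge it to an independent set, against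
  -- maximality.
  · by_contra hns
    have hins : (vectorMatroid (K := K) X).Indep (insert e B) :=
      (linearIndepOn_insert heB).2 ⟨hB.indep, hns⟩
    exact heB (hB.eq_of_subset_indep hins (Set.subset_insert e B) ▸ Set.mem_insert e B)

theorem clos_eq_topFlat_iff_spanning (X : Fin N → U) (A : Set (Fin N)) :
    clos X A = topFlat K X ↔ (vectorMatroid (K := K) X).Spanning A := by
  rw [Matroid.spanning_iff_closure_eq (hS := Set.subset_univ A), Subtype.ext_iff]
  rfl

theorem clos_eq_topFlat_iff (X : Fin N → U) (A : Set (Fin N)) :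
    clos X A = topFlat K X ↔ ∀ C : Flats K X, C ≠ topFlat K X → ¬ A ⊆ C.1 := by
  constructor
  · intro h C hC hAC
    refine hC (Subtype.ext (Set.eq_univ_of_univ_subset ?_))
    have hcl := (vectorMatroid (K := K) X).closure_subset_closure hAC
    rw [C.2.closure] at hcl
    rwa [show (vectorMatroid (K := K) X).closure A = Set.univ from congrArg Subtype.val h] at hcl
  · intro h
    by_contra hne
    -- The closure of `A` is itself a proper flat containing `A`.
    exact h _ hne ((vectorMatroid (K := K) X).subset_closure A (Set.subset_univ A))

theorem chi_univ {X : Fin N → U} (C : Flats K X) : chi Set.univ C = 1 := by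
  simp [chi]

theorem chi_nonneg {X : Fin N → U} (J : Set (Flats K X)) (C : Flats K X) : 0 ≤ chi J C := by
  unfold chi; split_ifs <;> simp

/-- Since `Y \ C` is contained in the complement of `C`, the inequality fails only when the two sets
are equal. -/
theorem ncard_sdiff_lt_m_iff {X : Fin N → U} (Y : Finset (Fin N)) (C : Flats K X) :
    ((Y : Set (Fin N)) \ C.1).ncard < m C ↔ ¬ (Y : Set (Fin N))ᶜ ⊆ C.1 := by
  have hsub : (Y : Set (Fin N)) \ C.1 ⊆ C.1ᶜ := fun _ h => h.2
  rw [m, ← not_le, not_iff_not]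
  constructor
  · intro hle e heY
    by_contra heC
    have heq := Set.eq_of_subset_of_ncard_le hsub hle (Set.toFinite _)
    exact heY (heq.symm ▸ (show e ∈ C.1ᶜ from heC) : e ∈ (Y : Set (Fin N)) \ C.1).1
  · intro h
    refine Set.ncard_le_ncard (fun e he => ⟨?_, he⟩) (Set.toFinite _)
    by_contra heY
    exact he (h heY)

theorem S_neg_one_univ (X : Fin N → U) :
    S (K := K) X (-1) Set.univ = S X 0 {topFlat K X} := by
  ext q
  simp only [S, chi_univ, show ¬ (1 : ℤ) ≤ -1 by decide, show ¬ (-1 : ℤ) = 0 by decide,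
    show ¬ (1 : ℤ) ≤ 0 by decide, if_false, if_true, Set.mem_ofPred_eq, Set.mem_singleton_iff,
    clos_eq_topFlat_iff, sub_add_cancel, Nat.cast_lt, ncard_sdiff_lt_m_iff]

theorem range_ι_pow_le_degreeLE {i d : ℕ} (h : i ≤ d) :
    LinearMap.range (SymmetricAlgebra.ι K U) ^ i ≤ degreeLE K U d :=
  le_iSup₂_of_le i h le_rfl

theorem degreeLE_mono {d e : ℕ} (h : d ≤ e) : degreeLE K U d ≤ degreeLE K U e :=
  iSup₂_le fun _ hi => range_ι_pow_le_degreeLE (hi.trans h)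

/-- For `k ≥ 0`, the space `P(X, k, L(X))` contains `f p_Y` whenever `deg f ≤ k`. -/
theorem mul_p_mem_PSpace_univ (X : Fin N → U) (Y : Finset (Fin N)) {d : ℕ}
    {f : SymmetricAlgebra K U} (hf : f ∈ degreeLE K U d) :
    f * p K X Y ∈ PSpace X d Set.univ := by
  -- At level `0` the generators carry no factor `f`; a factor of degree `0` is a scalar, which the
  -- span absorbs.
  rcases Nat.eq_zero_or_pos d with rfl | hd
  · have h0 : f ∈ (1 : Submodule K (SymmetricAlgebra K U)) := by
      have hle : degreeLE K U 0 ≤ 1 :=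
        iSup₂_le fun i hi => by rw [Nat.le_zero.1 hi, pow_zero]
      exact hle hf
    obtain ⟨c, rfl⟩ := Submodule.mem_one.1 h0
    rw [← Algebra.smul_def]
    refine Submodule.smul_mem _ c (Submodule.subset_span ?_)
    simp only [S, Nat.cast_zero, show ¬ (1 : ℤ) ≤ 0 by decide, if_false, if_true]
    exact ⟨Y, Set.mem_univ _, rfl⟩
  · rcases eq_or_ne f 0 with rfl | hf0
    · rw [zero_mul]; exact Submodule.zero_mem _
    · refine Submodule.subset_span ?_
      rw [S, if_pos (by exact_mod_cast hd)]
      exact ⟨Y, f, hf0, ⟨d, by rw [chi_univ]; omega, hf⟩, rfl⟩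

/-- If `X \ Y` spans `U`, a factor of degree one more can be expanded in the vectors of `X \ Y`. -/
theorem mul_p_mem_PSpace_univ_of_span (X : Fin N → U) (Y : Finset (Fin N))
    (hY : Submodule.span K (X '' (Y : Set (Fin N))ᶜ) = ⊤) {d : ℕ}
    {f : SymmetricAlgebra K U} (hf : f ∈ degreeLE K U (d + 1)) :
    f * p K X Y ∈ PSpace X d Set.univ := by
  suffices h : degreeLE K U (d + 1) ≤
      (PSpace X d Set.univ).comap (LinearMap.mulRight K (p K X Y)) from h hf
  refine iSup₂_le fun i hi => ?_
  rcases Nat.le_succ_iff.1 hi with hi | rfl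
  · exact fun g hg => mul_p_mem_PSpace_univ X Y (range_ι_pow_le_degreeLE hi hg)
  -- Only the component of degree `d + 1` remains; it is spanned by products `a * ι u` with `a` of
  -- degree `d`.
  rw [Nat.succ_eq_add_one, pow_succ, Submodule.mul_le]
  rintro a ha _ ⟨u, rfl⟩
  have hu : u ∈ Submodule.span K (X '' (Y : Set (Fin N))ᶜ) := hY ▸ Submodule.mem_top
  simp only [Submodule.mem_comap, LinearMap.mulRight_apply]
  induction hu using Submodule.span_induction with
  | mem _ hx =>
    obtain ⟨e, he, rfl⟩ := hx
    have hprod : p K X (insert e Y) = SymmetricAlgebra.ι K U (X e) * p K X Y :=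
      Finset.prod_insert (by simpa using he)
    rw [mul_assoc, ← hprod]
    exact mul_p_mem_PSpace_univ X _ (range_ι_pow_le_degreeLE le_rfl ha)
  | zero => simp
  | add x y _ _ hx hy =>
    rw [map_add, mul_add, add_mul]
    exact Submodule.add_mem _ hx hy
  | smul c x _ hx =>
    rw [map_smul, mul_smul_comm, smul_mul_assoc]
    exact Submodule.smul_mem _ c hx

/-- At level `n + 1` the degree bound is `χ + n`, which is at least `n` whatever `J` is. -/
theorem mul_p_mem_PSpace_add_one (X : Fin N → U) (J : Set (Flats K X)) (Y : Finset (Fin N))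
    {d n : ℕ} (hdn : d ≤ n) {f : SymmetricAlgebra K U} (hf : f ∈ degreeLE K U d) :
    f * p K X Y ∈ PSpace X (n + 1) J := by
  rcases eq_or_ne f 0 with rfl | hf0
  · rw [zero_mul]; exact Submodule.zero_mem _
  · refine Submodule.subset_span ?_
    rw [S, if_pos (by omega)]
    have := chi_nonneg J (clos X (Y : Set (Fin N))ᶜ)
    exact ⟨Y, f, hf0, ⟨d, by omega, hf⟩, rfl⟩

theorem PSpace_univ_le_PSpace_add_one (X : Fin N → U) (J : Set (Flats K X)) (n : ℕ) :
    PSpace X n Set.univ ≤ PSpace X (n + 1) J := by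
  refine Submodule.span_le.2 fun q hq => ?_
  rw [S] at hq
  split_ifs at hq with h1 h0
  · obtain ⟨Y, f, -, ⟨d, hd, hf⟩, rfl⟩ := hq
    rw [chi_univ] at hd
    exact mul_p_mem_PSpace_add_one X J Y (by omega) hf
  · obtain ⟨Y, -, rfl⟩ := hq
    rw [← one_mul (p K X Y)]
    refine mul_p_mem_PSpace_add_one X J Y (Nat.zero_le n) (range_ι_pow_le_degreeLE le_rfl ?_)
    rw [pow_zero]
    exact Submodule.one_le.1 le_rfl
  · omega

theorem PSpace_add_one_topFlat_le (X : Fin N → U) (hX : Submodule.span K (Set.range X) = ⊤)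
    (n : ℕ) : PSpace X (n + 1) {topFlat K X} ≤ PSpace X n Set.univ := by
  refine Submodule.span_le.2 fun q hq => ?_
  rw [S, if_pos (by omega)] at hq
  obtain ⟨Y, f, -, ⟨d, hd, hf⟩, rfl⟩ := hq
  by_cases hY : clos X (Y : Set (Fin N))ᶜ = topFlat K X
  · rw [chi, if_pos (by exact hY)] at hd
    refine mul_p_mem_PSpace_univ_of_span X Y ?_ (degreeLE_mono (by omega) hf)
    rw [span_image_eq_of_spanning X ((clos_eq_topFlat_iff_spanning X _).1 hY), hX]
  · rw [chi, if_neg (by exact hY)] at hd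
    exact mul_p_mem_PSpace_univ X Y (degreeLE_mono (by omega) hf)

end

end Zonotopal

theorem mainTheorem8 {K V : Type*} [Field K] [CharZero K] [AddCommGroup V] [Module K V]
    [FiniteDimensional K V] (hr : 1 ≤ Module.finrank K V)
    {N : ℕ} (X : Fin N → Module.Dual K V) (hX : Submodule.span K (Set.range X) = ⊤)
    (k : ℤ) (hk : -1 ≤ k) :
    Zonotopal.PSpace X k (Set.univ : Set (Zonotopal.Flats K X)) =
      Zonotopal.PSpace X (k + 1) {Zonotopal.topFlat K X} := by
  rcases hk.eq_or_lt with rfl | hk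
  · exact congrArg (Submodule.span K) (Zonotopal.S_neg_one_univ X)
  · obtain ⟨n, rfl⟩ := Int.eq_ofNat_of_zero_le (show 0 ≤ k by omega)
    exact le_antisymm (Zonotopal.PSpace_univ_le_PSpace_add_one X _ n)
      (Zonotopal.PSpace_add_one_topFlat_le X hX n)
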